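/- Let $k$ be a field, let $G=(V,E)$ be a finite simple graph with maximal degree $D$, and suppose that $G$ is $d$-degenerate, i.e. $V$ admits a linear order such that every vertex $v$ has at most $d$ neighbours $u$ with $u>v$. Let $W$ be a finite-dimensional vector space over $k$ with a non-degenerate bilinear form $\langle\cdot,\cdot\rangle$ that is symmetric or alternating. Let $X(G,W)$ be the closed subscheme of the affine space $W^{V}$ over $k$ defined by the equations $\langle w(v),w(u)\rangle=0$ for all edges $\{v,u\}\in E$. If $\dim W\ge d+D-1$, then $X(G,W)$ has dimension $|V|\cdot\dim W-|E|$. If $\dim W>d+D-1$, then $X(G,W)$ is moreover irreducible. -/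

import Mathlib

open AlgebraicGeometry

namespace GraphVar

/-- The neighbours of `v` in `G` that are larger than `v` for the given order. -/
def olderNeighbors {V : Type*} [LinearOrder V] (G : SimpleGraph V) (v : V) : Set V :=
  {u | v < u ∧ G.Adj v u}

/-- A graph is `d`-degenerate if its vertices can be linearly ordered in such a way that every
vertex has at most `d` larger neighbours. -/
def IsDegenerate {V : Type*} (G : SimpleGraph V) (d : ℕ) : Prop :=
  ∃ _ : LinearOrder V, ∀ v : V, (olderNeighbors G v).encard ≤ d

section Variety

variable {V k W ι : Type*} [Field k] [AddCommGroup W] [Module k W]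

/-- The polynomial function `w ↦ B (w v) (w u)` on `W ^ V`, written in the linear coordinates
given by a basis `b` of `W`: the variable `(v, i)` is the `i`-th coordinate of `w v`. -/
noncomputable def pairingPoly [Fintype ι] (B : LinearMap.BilinForm k W)
    (b : Module.Basis ι k W) (v u : V) : MvPolynomial (V × ι) k :=
  ∑ i, ∑ j, MvPolynomial.C (B (b i) (b j)) * MvPolynomial.X (v, i) * MvPolynomial.X (u, j)

/-- `pairingPoly` is indeed the function `w ↦ B (w v) (w u)`. -/
theorem eval_pairingPoly [Fintype ι] (B : LinearMap.BilinForm k W)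
    (b : Module.Basis ι k W) (v u : V) (w : V → W) :
    MvPolynomial.eval (fun p : V × ι => b.repr (w p.1) p.2) (pairingPoly B b v u)
      = B (w v) (w u) := by
  conv_rhs => rw [← b.sum_repr (w v), ← b.sum_repr (w u)]
  simp only [pairingPoly, map_sum, map_mul, MvPolynomial.eval_C, MvPolynomial.eval_X,
    LinearMap.sum_apply, map_smul, LinearMap.smul_apply, smul_eq_mul]
  rw [Finset.sum_comm]
  refine Finset.sum_congr rfl fun i _ => ?_
  rw [Finset.mul_sum]
  exact Finset.sum_congr rfl fun j _ => by ring

/-- The ideal generated by the equations `B (w v) (w u) = 0`, one for each edge `{v, u}`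
(taken in both orders). -/
noncomputable def graphIdeal [Fintype ι] (G : SimpleGraph V) (B : LinearMap.BilinForm k W)
    (b : Module.Basis ι k W) : Ideal (MvPolynomial (V × ι) k) :=
  Ideal.span {f | ∃ v u : V, G.Adj v u ∧ f = pairingPoly B b v u}

/-- The graph variety `X(G, W)`: the closed subscheme of the affine space `W ^ V` over `k` defined
by the equations `B (w v) (w u) = 0` for all edges `{v, u}` of `G`. A basis of `W` is chosen in
order to write the equations; another basis gives an isomorphic scheme. -/
noncomputable def graphVariety (G : SimpleGraph V) [FiniteDimensional k W]
    (B : LinearMap.BilinForm k W) : Scheme :=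
  Spec (CommRingCat.of
    (MvPolynomial (V × Fin (Module.finrank k W)) k ⧸ graphIdeal G B (Module.finBasis k W)))

end Variety

/-- The expected dimension `|V| * dim W - |E|` of the graph variety. -/
noncomputable def expectedDim {V : Type*} [Fintype V] [DecidableEq V] (G : SimpleGraph V)
    [DecidableRel G.Adj] (k W : Type*) [Field k] [AddCommGroup W] [Module k W] : ℤ :=
  (Fintype.card V : ℤ) * (Module.finrank k W : ℤ) - (G.edgeFinset.card : ℤ)

end GraphVar

/-! A prime of the coordinate ring is studied through its tautological point `w`, whose coordinates
lie in the residue field. In a polynomial ring the height of a prime is at least the number of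
variables minus the transcendence degree `trk` of these coordinates (`card_le_height_add_trk`).
Bounding the dimension from above thus amounts to bounding `trk` at all points over all extension
fields.

Let n = dim W, and let e(S) be the number of edges inside a vertex set S. The bound trk + e(S) ≤
|S|n is proved by induction on S. Some v in S has at most d neighbours in S; let r be the rank of
the vectors at these neighbours, and r + c their number. Then `w v` solves r independent linear
equations and adds at most n - r to the transcendence degree. The c dependent vectors add at most r
each, and deleting v and these c vertices loses at most r + c + c(D - 1) edges. Hence trk + e(S) ≤
|S|n - c(n - D - r) (`exists_rank_defect`). If c > 0 then r ≤ d - 1, so n ≥ d + D - 1 makes the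
correction harmless. The lower bound on the dimension is Krull's height theorem at the origin.

Krull's theorem also shows that the tautological point of every minimal prime attains the bound. If
n > d + D - 1, this forces c = 0, and `w v` is then a generic solution of a linear system of full
rank over the field of the other vectors. By induction all such points satisfy the same polynomial
equations (`evalAt_eq_zero_iff_of_generic`), so there is only one minimal prime. -/

namespace GraphVar

/-! ### Transcendence degree as a matroid rank. -/

section TranscendenceRank

variable (k : Type*) {K : Type*} [Field k] [Field K] [Algebra k K]

/-- The transcendence degree over `k` of the field generated by a set `X`, as a natural number
(meaningful when it is finite, in particular for finite `X`). -/
noncomputable def trk (X : Set K) : ℕ := ((AlgebraicIndependent.matroid k K).eRk X).toNat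

variable {k}

theorem coe_trk {X : Set K} (hX : X.Finite) :
    (trk k X : ℕ∞) = (AlgebraicIndependent.matroid k K).eRk X :=
  ENat.natCast_toNat (ne_top_of_le_ne_top hX.encard_lt_top.ne (Matroid.eRk_le_encard _ _))

theorem trk_le_of_subset_closure {X Y : Set K} (hY : Y.Finite)
    (h : X ⊆ (AlgebraicIndependent.matroid k K).closure Y) : trk k X ≤ trk k Y := by
  refine ENat.toNat_le_toNat ?_
    (ne_top_of_le_ne_top hY.encard_lt_top.ne (Matroid.eRk_le_encard _ _))
  rw [← Matroid.eRk_closure_eq _ Y]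
  exact Matroid.eRk_mono _ h

theorem trk_union_le {X : Set K} (hX : X.Finite) {τ : Type*} [Fintype τ] (t : τ → K) :
    trk k (X ∪ Set.range t) ≤ trk k X + Fintype.card τ := by
  have h1 : ((Set.range t).encard : ℕ∞) ≤ Fintype.card τ := by
    rw [← Set.image_univ]
    exact (Set.encard_image_le _ _).trans (by simp)
  have := (Matroid.eRk_union_le_eRk_add_encard (AlgebraicIndependent.matroid k K) X
    (Set.range t)).trans (add_le_add le_rfl h1)
  rw [← coe_trk hX, ← coe_trk (hX.union (Set.finite_range t))] at this
  exact_mod_cast this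

theorem mem_closure_iff {X : Set K} {x : K} :
    x ∈ (AlgebraicIndependent.matroid k K).closure X ↔ IsAlgebraic (Algebra.adjoin k X) x := by
  rw [AlgebraicIndependent.matroid_closure_eq]
  rfl

theorem subset_closure (X : Set K) : X ⊆ (AlgebraicIndependent.matroid k K).closure X :=
  (AlgebraicIndependent.matroid k K).subset_closure X (Set.subset_univ _)

theorem adjoin_subset_closure (X : Set K) :
    (IntermediateField.adjoin k X : Set K) ⊆ (AlgebraicIndependent.matroid k K).closure X := by
  intro x hx
  rw [mem_closure_iff]
  induction hx using IntermediateField.adjoin_induction with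
  | mem x hx => exact mem_closure_iff.mp (subset_closure X hx)
  | algebraMap x => exact isAlgebraic_algebraMap (algebraMap k (Algebra.adjoin k X) x)
  | add x y _ _ hx hy => exact hx.add hy
  | inv x _ hx => exact hx.inv
  | mul x y _ _ hx hy => exact hx.mul hy

theorem adjoin_subset_closure_of_subset {X Y : Set K}
    (h : X ⊆ (AlgebraicIndependent.matroid k K).closure Y) :
    (IntermediateField.adjoin k X : Set K) ⊆ (AlgebraicIndependent.matroid k K).closure Y :=
  (adjoin_subset_closure X).trans
    ((Matroid.closure_subset_closure _ h).trans (Matroid.closure_closure _ _).subset)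

/-- If adding the family `t` raises the transcendence degree by the number of its members, then
`t` is algebraically independent over every field contained in the algebraic closure of `k(X)`. -/
theorem algebraicIndependent_of_trk {X : Set K} (hX : X.Finite) {τ : Type*} [Fintype τ] (t : τ → K)
    (h : trk k X + Fintype.card τ ≤ trk k (X ∪ Set.range t))
    (L : Type*) [Field L] [Algebra L K]
    (hL : ∀ l : L, algebraMap L K l ∈ (AlgebraicIndependent.matroid k K).closure X) :
    AlgebraicIndependent L t := by
  classical
  obtain ⟨I, hI⟩ := (AlgebraicIndependent.matroid k K).exists_isBasis X
  have hIfin : I.Finite := hX.subset hI.subset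
  have hfin : (I ∪ Set.range t).Finite := hIfin.union (Set.finite_range t)
  have hIt := Matroid.IsBasis.eRk_eq_eRk_union hI (Set.range t)
  have hIcard := hI.encard_eq_eRk
  rw [← coe_trk (hX.union (Set.finite_range t))] at hIt
  rw [← coe_trk hX] at hIcard
  have hrt : (Set.range t).encard ≤ Fintype.card τ := by
    rw [← Set.image_univ]
    exact (Set.encard_image_le _ _).trans (by simp)
  have hle : (I.encard + Fintype.card τ : ℕ∞) ≤
      (AlgebraicIndependent.matroid k K).eRk (I ∪ Set.range t) := by
    rw [hIt, hIcard]; exact_mod_cast h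
  have hun := Set.encard_union_add_encard_inter I (Set.range t)
  -- The rank is at least `I.encard + card τ`, hence at least the cardinality of the set. The same
  -- count leaves no room for an overlap with `I` or a repetition in `t`.
  have hind : (AlgebraicIndependent.matroid k K).Indep (I ∪ Set.range t) := by
    rw [Matroid.indep_iff_eRk_eq_encard_of_finite hfin]
    refine le_antisymm (Matroid.eRk_le_encard _ _) (le_trans ?_ hle)
    exact (Set.encard_union_le _ _).trans (add_le_add le_rfl hrt)
  rw [hind.eRk_eq_encard] at hle
  have hfI : I.encard = I.ncard := hIfin.cast_ncard_eq.symm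
  have hft : (Set.range t).encard = (Set.range t).ncard :=
    (Set.finite_range t).cast_ncard_eq.symm
  have hfu : (I ∪ Set.range t).encard = (I ∪ Set.range t).ncard := hfin.cast_ncard_eq.symm
  have hfi : (I ∩ Set.range t).encard = (I ∩ Set.range t).ncard :=
    (hIfin.subset Set.inter_subset_left).cast_ncard_eq.symm
  rw [hfI, hfu] at hle
  rw [hft] at hrt
  rw [hfI, hfu, hft, hfi] at hun
  norm_cast at hle hrt hun
  have hinter : (I ∩ Set.range t).ncard = 0 := by omega
  have hcard : (Set.range t).ncard = Fintype.card τ := by omega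
  have hdisj : I ∩ Set.range t = ∅ :=
    (Set.ncard_eq_zero (hIfin.subset Set.inter_subset_left)).mp hinter
  have hinj : Function.Injective t := by
    rw [← Finset.card_univ, ← Set.image_univ, ← Finset.coe_univ, ← Finset.coe_image,
      Set.ncard_coe_finset] at hcard
    exact fun a b hab => Finset.card_image_iff.mp hcard (by simp) (by simp) hab
  have hind' : AlgebraicIndependent k (Sum.elim t ((↑) : I → K)) := by
    let g : τ ⊕ I → (I ∪ Set.range t : Set K) :=
      Sum.elim (fun a => ⟨t a, Or.inr ⟨a, rfl⟩⟩) (fun a => ⟨a, Or.inl a.2⟩)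
    have hg : Function.Injective g := by
      rintro (a | a) (b | b) hab
      · exact congrArg _ (hinj (congrArg Subtype.val hab))
      · have : (b : K) ∈ I ∩ Set.range t := ⟨b.2, a, congrArg Subtype.val hab⟩
        simp [hdisj] at this
      · have : (a : K) ∈ I ∩ Set.range t := ⟨a.2, b, (congrArg Subtype.val hab).symm⟩
        simp [hdisj] at this
      · have := congrArg Subtype.val hab
        exact congrArg _ (Subtype.ext this)
    have := AlgebraicIndependent.comp (AlgebraicIndependent.matroid_indep_iff.mp hind) g hg
    convert this using 1
    ext (a | a) <;> rfl
  have h3 := (AlgebraicIndependent.sumElim_iff.mp hind').2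
  rw [Subtype.range_coe] at h3
  -- Independence over `k[I]` persists over its algebraic closure in `K`, which contains the image
  -- of `L`.
  have h4 := h3.subalgebraAlgebraicClosure
  have hmem : ∀ l : L, algebraMap L K l ∈
      Subalgebra.algebraicClosure (Algebra.adjoin k I) K := fun l => by
    have := hL l
    rw [← hI.closure_eq_closure, mem_closure_iff] at this
    exact this
  let φ : L →+* Subalgebra.algebraicClosure (Algebra.adjoin k I) K :=
    (algebraMap L K).codRestrict (Subalgebra.algebraicClosure (Algebra.adjoin k I) K) hmem
  let _ : Algebra L (Subalgebra.algebraicClosure (Algebra.adjoin k I) K) := φ.toAlgebra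
  have : IsScalarTower L (Subalgebra.algebraicClosure (Algebra.adjoin k I) K) K :=
    .of_algebraMap_eq fun l => rfl
  exact h4.restrictScalars φ.injective

end TranscendenceRank

end GraphVar

namespace GraphVar

/-! ### Height and transcendence degree in polynomial rings. -/

section Height

variable {k K : Type*} [Field k] [Field K] [Algebra k K]

theorem trk_insert {X : Set K} (hX : X.Finite) {x : K}
    (hx : Transcendental (Algebra.adjoin k X) x) : trk k (insert x X) = trk k X + 1 := by
  have := Matroid.eRk_insert_eq_add_one (M := AlgebraicIndependent.matroid k K) (X := X) (e := x)
    ⟨Set.mem_univ _, fun h => hx (mem_closure_iff.mp h)⟩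
  rw [← coe_trk hX, ← coe_trk (hX.insert x)] at this
  exact_mod_cast this

/-- Going-down holds for `R → R[X]`, and the extended prime lies over `q`. -/
theorem height_le_height_map_C {R : Type*} [CommRing R] [IsNoetherianRing R] (q : Ideal R)
    [q.IsPrime] : q.height ≤ (q.map Polynomial.C).height := by
  have : (q.map Polynomial.C).IsPrime := Ideal.isPrime_map_C_of_isPrime
  have hl : (q.map Polynomial.C).LiesOver q := ⟨by
    ext x
    rw [Ideal.under_def, Ideal.mem_comap, Polynomial.algebraMap_eq, Ideal.mem_map_C_iff]
    refine ⟨fun hx n => ?_, fun h => by simpa using h 0⟩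
    rw [Polynomial.coeff_C]
    split_ifs
    exacts [hx, q.zero_mem]⟩
  rw [Ideal.height_eq_height_add_of_liesOver_of_hasGoingDown q (P := q.map Polynomial.C)]
  exact le_self_add

/-- An algebraic relation for `x` over `A` lifts coefficientwise to `R[X]`; the lift is in the
kernel, so all its coefficients are killed by `f`. -/
theorem transcendental_of_ker_eq_map_C {R : Type*} [CommRing R] (f : R →+* K)
    (x : K) (h : RingHom.ker (Polynomial.eval₂RingHom f x) = (RingHom.ker f).map Polynomial.C)
    {A : Type*} [CommRing A] [Algebra A K] (hA : Function.Injective (algebraMap A K))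
    (hf : Set.range (algebraMap A K) ⊆ Set.range f) :
    Transcendental A x := by
  rw [transcendental_iff]
  intro p hp
  choose g hg using fun a : A => hf ⟨a, rfl⟩
  let P : Polynomial R := ∑ i ∈ p.support, Polynomial.monomial i (g (p.coeff i))
  have hP : P.map f = p.map (algebraMap A K) := by
    conv_rhs => rw [p.as_sum_support]
    simp [P, Polynomial.map_sum, hg]
  have hmem : P ∈ RingHom.ker (Polynomial.eval₂RingHom f x) := by
    rw [RingHom.mem_ker, Polynomial.coe_eval₂RingHom, Polynomial.eval₂_eq_eval_map, hP,
      Polynomial.eval_map_algebraMap, hp]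
  rw [h, Ideal.mem_map_C_iff] at hmem
  have : P.map f = 0 := by
    ext n
    simpa using hmem n
  rw [hP] at this
  exact (Polynomial.map_eq_zero_iff hA).mp this

/-- The dimension inequality for the polynomial ring: a point with values in an extension field
has height at least the number of variables minus its transcendence degree. -/
theorem card_le_height_add_trk (σ : Type*) [Finite σ] : ∀ w : σ → K,
    (Nat.card σ : ℕ∞) ≤
      (RingHom.ker (MvPolynomial.aeval (R := k) w).toRingHom).height + trk k (Set.range w) := by
  induction σ using Finite.induction_empty_option with
  | of_equiv e h =>
    intro w
    rename_i α β
    have h1 := h (w ∘ e)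
    rw [e.surjective.range_comp] at h1
    rw [← Nat.card_congr e]
    convert h1 using 2
    rw [← (MvPolynomial.renameEquiv k e).toRingEquiv.height_comap]
    congr 1
    ext f
    simp [RingHom.mem_ker, MvPolynomial.aeval_rename]
  | h_empty => intro w; simp
  | h_option h =>
    rename_i σ _
    intro w
    let w' : σ → K := fun i => w (some i)
    let q := RingHom.ker (MvPolynomial.aeval (R := k) w').toRingHom
    have hq : q.IsPrime := RingHom.ker_isPrime _
    let ψ := Polynomial.eval₂RingHom (MvPolynomial.aeval (R := k) w').toRingHom (w none)
    have hψ : (RingHom.ker ψ).IsPrime := RingHom.ker_isPrime _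
    have hht : (RingHom.ker (MvPolynomial.aeval (R := k) w).toRingHom).height =
        (RingHom.ker ψ).height := by
      rw [← (MvPolynomial.optionEquivLeft k σ).toRingEquiv.height_comap]
      congr 1
      ext f
      have : (MvPolynomial.aeval (R := k) w).toRingHom =
          ψ.comp (MvPolynomial.optionEquivLeft k σ).toAlgHom.toRingHom := by
        apply MvPolynomial.ringHom_ext
        · intro r
          simp [ψ, MvPolynomial.optionEquivLeft_C]
        · rintro (_ | i) <;> simp [ψ, w']
      rw [this]
      rfl
    rw [hht]
    have hrange : Set.range w = insert (w none) (Set.range w') := by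
      ext x
      simp [w', Option.exists, eq_comm]
    have hle : q.map Polynomial.C ≤ RingHom.ker ψ := by
      rw [Ideal.map_le_iff_le_comap]
      intro r hr
      have : MvPolynomial.aeval (R := k) w' r = 0 := hr
      simpa [ψ, RingHom.mem_ker] using this
    have hC : (q.map Polynomial.C).IsPrime := Ideal.isPrime_map_C_of_isPrime
    have hqle := height_le_height_map_C q
    have ih := h w'
    rw [Finite.card_option, hrange]
    push_cast
    -- The extra variable raises the transcendence degree if the kernel is extended from `q`, and
    -- otherwise the height.
    rcases hle.eq_or_lt with heq | hlt
    · rw [trk_insert (Set.finite_range w'), ← heq]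
      · push_cast
        rw [← add_assoc]
        exact add_le_add (ih.trans (add_le_add hqle le_rfl)) le_rfl
      · refine transcendental_of_ker_eq_map_C _ _ heq.symm Subtype.val_injective ?_
        rintro _ ⟨⟨a, ha⟩, rfl⟩
        rw [Algebra.adjoin_range_eq_range_aeval] at ha
        exact ha
    · have h1 := Ideal.height_add_one_le_of_lt_of_isPrime hlt
      have h2 : trk k (Set.range w') ≤ trk k (insert (w none) (Set.range w')) :=
        trk_le_of_subset_closure ((Set.finite_range w').insert _)
          ((Set.subset_insert _ _).trans (subset_closure _))
      calc (Nat.card σ : ℕ∞) + 1 ≤ q.height + trk k (Set.range w') + 1 := add_le_add ih le_rfl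
        _ = (q.height + 1) + trk k (Set.range w') := by ring
        _ ≤ _ := add_le_add ((add_le_add hqle le_rfl).trans h1) (by exact_mod_cast h2)

end Height

end GraphVar

namespace GraphVar

/-! ### Linear parametrization of solution spaces. -/

/-- The kernel of a matrix with independent rows, parametrized by matrices over the same field. -/
theorem exists_parametrization_ker {L ι ρ : Type*} [Field L] [Fintype ι] [DecidableEq ι]
    [Fintype ρ] [DecidableEq ρ] (M : Matrix ρ ι L) (hM : LinearIndependent L M) :
    Fintype.card ρ ≤ Fintype.card ι ∧
    ∃ (U : Matrix ι (Fin (Fintype.card ι - Fintype.card ρ)) L)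
      (T : Matrix (Fin (Fintype.card ι - Fintype.card ρ)) ι L) (Q : Matrix ι ρ L),
      U * T + Q * M = 1 := by
  have hrank : M.rank = Fintype.card ρ := LinearIndependent.rank_matrix hM
  let f := Matrix.toLin' M
  have hf : LinearMap.range f = ⊤ := by
    apply Submodule.eq_top_of_finrank_eq
    rw [Module.finrank_fintype_fun_eq_card, ← hrank]
    rfl
  have hker := LinearMap.finrank_range_add_finrank_ker f
  rw [hf, finrank_top, Module.finrank_fintype_fun_eq_card, Module.finrank_fintype_fun_eq_card]
    at hker
  refine ⟨by omega, ?_⟩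
  -- With a section `g` of `f`, the map `1 - g ∘ f` projects onto the kernel. In a basis of the
  -- kernel, `T` is this projection, `U` the inclusion and `Q` the section.
  obtain ⟨g, hg⟩ := f.exists_rightInverse_of_surjective hf
  let b := Module.finBasisOfFinrankEq L (LinearMap.ker f)
    (show _ = Fintype.card ι - Fintype.card ρ by omega)
  let π : (ι → L) →ₗ[L] LinearMap.ker f := LinearMap.codRestrict _ (LinearMap.id - g ∘ₗ f) fun x => by
    have := LinearMap.congr_fun hg (f x)
    simp only [LinearMap.comp_apply, LinearMap.id_apply] at this
    simp [this]
  let u := (LinearMap.ker f).subtype ∘ₗ b.equivFun.symm.toLinearMap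
  let s := b.equivFun.toLinearMap ∘ₗ π
  refine ⟨LinearMap.toMatrix' u, LinearMap.toMatrix' s, LinearMap.toMatrix' g, ?_⟩
  rw [← LinearMap.toMatrix'_toLin' M, ← LinearMap.toMatrix'_comp, ← LinearMap.toMatrix'_comp,
    ← map_add, ← LinearMap.toMatrix'_id]
  congr 1
  refine LinearMap.ext fun x => ?_
  simp [u, s, π, f]

/-- A matrix identity survives any field homomorphism, so one parametrization over `L` serves all
extensions of `L`. -/
theorem mulVec_map_parametrization {L K ι ρ τ : Type*} [Field L] [Field K] [Fintype ι]
    [DecidableEq ι] [Fintype ρ] [Fintype τ] (φ : L →+* K) {M : Matrix ρ ι L} {U : Matrix ι τ L}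
    {T : Matrix τ ι L} {Q : Matrix ι ρ L} (h : U * T + Q * M = 1) {x : ι → K}
    (hx : (M.map φ).mulVec x = 0) : (U.map φ).mulVec ((T.map φ).mulVec x) = x := by
  have h' := congrArg (fun Z => (Matrix.map Z φ).mulVec x) h
  simp only [Matrix.map_add φ (map_add φ), Matrix.map_mul, Matrix.add_mulVec,
    Matrix.map_one φ (map_zero φ) (map_one φ), Matrix.one_mulVec, ← Matrix.mulVec_mulVec, hx,
    Matrix.mulVec_zero, add_zero] at h'
  exact h'

end GraphVar

namespace GraphVar

/-! ### Coordinates attached to a set of vertices. -/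

section Coords

variable {K V ι : Type*}

/-- The coordinates of the vectors `w v` with `v ∈ S`. -/
def coords (w : V → ι → K) (S : Finset V) : Set K :=
  Set.range fun p : S × ι => w p.1 p.2

theorem finite_coords [Finite ι] (w : V → ι → K) (S : Finset V) : (coords w S).Finite :=
  Set.finite_range _

theorem mem_coords {w : V → ι → K} {S : Finset V} {v : V} (hv : v ∈ S) (i : ι) :
    w v i ∈ coords w S := ⟨(⟨v, hv⟩, i), rfl⟩

theorem coords_mono (w : V → ι → K) {S T : Finset V} (h : S ⊆ T) : coords w S ⊆ coords w T := by
  rintro _ ⟨⟨⟨v, hv⟩, i⟩, rfl⟩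
  exact mem_coords (h hv) i

theorem coords_eq_union [DecidableEq V] (w : V → ι → K) {S : Finset V} {v : V} (hv : v ∈ S) :
    coords w S = coords w (S.erase v) ∪ Set.range (w v) := by
  ext x
  constructor
  · rintro ⟨⟨⟨u, hu⟩, i⟩, rfl⟩
    by_cases h : u = v
    · subst h; exact Or.inr ⟨i, rfl⟩
    · exact Or.inl (mem_coords (Finset.mem_erase.mpr ⟨h, hu⟩) i)
  · rintro (h | ⟨i, rfl⟩)
    · exact coords_mono w (Finset.erase_subset _ _) h
    · exact mem_coords hv i

end Coords

/-! ### Points over extension fields and the growth of their transcendence degree. -/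

section Points

variable {k K V ι : Type*} [Field k] [Field K] [Algebra k K] [Fintype ι]

/-- `w` is a point of the graph variety with coordinates in the extension field `K`, for the
bilinear form with Gram matrix `A`. -/
def IsPoint (G : SimpleGraph V) (A : Matrix ι ι k) (w : V → ι → K) : Prop :=
  ∀ v u, G.Adj v u → w v ⬝ᵥ (A.map (algebraMap k K)).mulVec (w u) = 0

/-- A linear combination with coefficients in a field algebraic over `k(X)` depends algebraically
on the combined elements. -/
theorem sum_mul_mem_closure {X : Set K} {τ : Type*} [Fintype τ] (a b : τ → K)
    (ha : ∀ j, a j ∈ (AlgebraicIndependent.matroid k K).closure X)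
    (hb : ∀ j, b j ∈ (AlgebraicIndependent.matroid k K).closure X) :
    ∑ j, a j * b j ∈ (AlgebraicIndependent.matroid k K).closure X := by
  apply adjoin_subset_closure_of_subset (X := (AlgebraicIndependent.matroid k K).closure X)
    subset_rfl
  exact sum_mem fun j _ => mul_mem (IntermediateField.subset_adjoin _ _ (ha j))
    (IntermediateField.subset_adjoin _ _ (hb j))

theorem closure_mono {X Y : Set K} (h : X ⊆ Y) :
    (AlgebraicIndependent.matroid k K).closure X ⊆
      (AlgebraicIndependent.matroid k K).closure Y :=
  (AlgebraicIndependent.matroid k K).closure_subset_closure h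

/-- The rows of the linear system satisfied by a vector orthogonal to given independent vectors
are independent, also over a smaller field. -/
theorem linearIndependent_rows [DecidableEq ι] {L : Type*} [Field L] [Algebra k L] [Algebra L K]
    [IsScalarTower k L K] {A : Matrix ι ι k} (hA : A.det ≠ 0) {ρ : Type*} [Fintype ρ]
    (x : ρ → ι → L) (hx : LinearIndependent K fun (u : ρ) (i : ι) => algebraMap L K (x u i)) :
    LinearIndependent L fun u => (A.map (algebraMap k L)).mulVec (x u) := by
  have hx' : LinearIndependent L x := by
    rw [Fintype.linearIndependent_iff] at hx ⊢
    intro g hg a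
    have := hx (fun u => algebraMap L K (g u)) (by
      ext i
      have := congrArg (algebraMap L K) (congrFun hg i)
      simpa [Algebra.smul_def] using this) a
    simpa using this
  have hdet : (A.map (algebraMap k L)).det ≠ 0 := by
    rw [← RingHom.mapMatrix_apply, ← RingHom.map_det]
    simpa using hA
  refine hx'.map' (Matrix.mulVecLin (A.map (algebraMap k L))) ?_
  rw [LinearMap.ker_eq_bot]
  exact Matrix.mulVec_injective_of_isUnit
    ((Matrix.isUnit_iff_isUnit_det _).mpr (isUnit_iff_ne_zero.mpr hdet))

theorem map_rows_mulVec {L : Type*} [Field L] [Algebra k L] [Algebra L K]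
    [IsScalarTower k L K] {A : Matrix ι ι k} {ρ : Type*} (x : ρ → ι → L) {y : ι → K}
    (hy : ∀ u, y ⬝ᵥ (A.map (algebraMap k K)).mulVec (fun i => algebraMap L K (x u i)) = 0) :
    (Matrix.map (fun u => (A.map (algebraMap k L)).mulVec (x u) : Matrix ρ ι L)
      (algebraMap L K)).mulVec y = 0 := by
  ext u
  rw [Pi.zero_apply, ← hy u, dotProduct_comm]
  change (fun i => algebraMap L K ((A.map (algebraMap k L)).mulVec (x u) i)) ⬝ᵥ y = _
  simp only [Matrix.mulVec, dotProduct, Matrix.map_apply, map_sum, map_mul,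
    ← IsScalarTower.algebraMap_apply]

variable [DecidableEq V]

theorem trk_coords_le_of_eq_mulVec (w : V → ι → K) {S : Finset V} {v : V} (hv : v ∈ S)
    {τ : Type*} [Fintype τ] (U : Matrix ι τ K)
    (hU : ∀ i j, U i j ∈ (AlgebraicIndependent.matroid k K).closure (coords w (S.erase v)))
    (t : τ → K) (h : U.mulVec t = w v) :
    trk k (coords w S) ≤ trk k (coords w (S.erase v) ∪ Set.range t) := by
  apply trk_le_of_subset_closure ((finite_coords w _).union (Set.finite_range t))
  rw [coords_eq_union w hv, Set.union_subset_iff]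
  refine ⟨Set.subset_union_left.trans (subset_closure _), ?_⟩
  rintro _ ⟨i, rfl⟩
  rw [← h]
  exact sum_mul_mem_closure _ _ (fun j => closure_mono Set.subset_union_left (hU i j))
    fun j => subset_closure _ (Or.inr ⟨j, rfl⟩)

/-- A vector orthogonal to `r` independent vectors adds at most `dim W - r` to the transcendence
degree. -/
theorem trk_coords_add_le [DecidableEq ι] {G : SimpleGraph V} {A : Matrix ι ι k}
    (hA : A.det ≠ 0) {w : V → ι → K} (hw : IsPoint G A w) {S : Finset V} {v : V} (hv : v ∈ S) {R : Finset V}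
    (hR : R ⊆ S.erase v) (hadj : ∀ u ∈ R, G.Adj v u)
    (hli : LinearIndependent K fun u : R => w u) :
    R.card ≤ Fintype.card ι ∧
      trk k (coords w S) + R.card ≤ trk k (coords w (S.erase v)) + Fintype.card ι := by
  -- The linear system for `w v` has coefficients in this field, so its solutions are parametrized
  -- over it and only the parameters are new.
  let L := IntermediateField.adjoin k (coords w (S.erase v))
  let x : R → ι → L := fun u i =>
    ⟨w u i, IntermediateField.subset_adjoin _ _ (mem_coords (hR u.2) i)⟩
  obtain ⟨hle, U, T, Q, h⟩ := exists_parametrization_ker _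
    (linearIndependent_rows (K := K) hA x hli)
  have h1 := mulVec_map_parametrization (algebraMap L K) h (x := w v)
    (map_rows_mulVec x fun u => hw v u (hadj u u.2))
  have h2 := trk_coords_le_of_eq_mulVec (k := k) w hv (U.map (algebraMap L K))
    (fun i j => adjoin_subset_closure _ (U i j).2) _ h1
  have h3 := trk_union_le (k := k) (finite_coords w (S.erase v))
    ((T.map (algebraMap L K)).mulVec (w v))
  rw [Fintype.card_fin] at h3
  have h4 := Fintype.card_coe R
  omega

/-- Vectors in the span of `r` others add at most `r` each to the transcendence degree. -/
theorem trk_coords_le_of_span (w : V → ι → K) {S C R : Finset V} (hC : Disjoint C R)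
    (hRS : R ⊆ S) (h : ∀ u ∈ C, w u ∈ Submodule.span K (w '' R)) :
    trk k (coords w S) ≤ trk k (coords w (S \ C)) + C.card * R.card := by
  have h' : ∀ u : C, ∃ c : R → K, ∑ b, c b • w b = w u := fun u => by
    have := h u u.2
    rw [Set.image_eq_range] at this
    exact (Submodule.mem_span_range_iff_exists_fun K).mp this
  choose c hc using h'
  have h1 : trk k (coords w S) ≤
      trk k (coords w (S \ C) ∪ Set.range fun p : C × R => c p.1 p.2) := by
    apply trk_le_of_subset_closure ((finite_coords w _).union (Set.finite_range _))
    rintro _ ⟨⟨⟨u, hu⟩, i⟩, rfl⟩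
    by_cases huC : u ∈ C
    · have := congrFun (hc ⟨u, huC⟩) i
      simp only [Finset.sum_apply, Pi.smul_apply, smul_eq_mul] at this
      change w u i ∈ _
      rw [← this]
      refine sum_mul_mem_closure _ _ (fun j => subset_closure _ (Or.inr ⟨(_, j), rfl⟩))
        fun j => subset_closure _ (Or.inl (mem_coords ?_ i))
      exact Finset.mem_sdiff.mpr ⟨hRS j.2, fun hj => Finset.disjoint_left.mp hC hj j.2⟩
    · exact subset_closure _ (Or.inl (mem_coords (Finset.mem_sdiff.mpr ⟨hu, huC⟩) i))
  have h2 := trk_union_le (k := k) (finite_coords w (S \ C)) fun p : C × R => c p.1 p.2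
  rw [Fintype.card_prod, Fintype.card_coe, Fintype.card_coe] at h2
  exact h1.trans h2

end Points

/-! ### Counting edges inside a vertex set. -/

section Edges

variable {V : Type*} [Fintype V] [DecidableEq V] (G : SimpleGraph V) [DecidableRel G.Adj]

/-- The number of edges of `G` with both ends in `S`. -/
def edgesIn (S : Finset V) : ℕ := (G.edgeFinset.filter fun e => ∀ x ∈ e, x ∈ S).card

theorem edgesIn_univ : edgesIn G Finset.univ = G.edgeFinset.card := by
  simp [edgesIn]

theorem edgesIn_erase {S : Finset V} {v : V} (hv : v ∈ S) :
    edgesIn G S = edgesIn G (S.erase v) + (G.neighborFinset v ∩ S).card := by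
  have hinj : Set.InjOn (fun u => s(v, u)) (G.neighborFinset v ∩ S : Finset V) := by
    intro a _ b _ hab
    exact Sym2.congr_right.mp hab
  rw [edgesIn, edgesIn, ← Finset.card_image_of_injOn hinj, ← Finset.card_union_of_disjoint]
  · congr 1
    ext e
    induction e using Sym2.ind with
    | _ a b =>
      simp only [Finset.mem_filter, Finset.mem_union, Finset.mem_image, Finset.mem_inter,
        SimpleGraph.mem_edgeFinset, SimpleGraph.mem_edgeSet, SimpleGraph.mem_neighborFinset,
        Sym2.mem_iff, forall_eq_or_imp, forall_eq, Finset.mem_erase, Sym2.eq_iff]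
      constructor
      · rintro ⟨hab, ha, hb⟩
        by_cases h1 : a = v
        · subst h1
          exact Or.inr ⟨b, ⟨hab, hb⟩, Or.inl ⟨rfl, rfl⟩⟩
        · by_cases h2 : b = v
          · subst h2
            exact Or.inr ⟨a, ⟨hab.symm, ha⟩, Or.inr ⟨rfl, rfl⟩⟩
          · exact Or.inl ⟨hab, ⟨h1, ha⟩, h2, hb⟩
      · rintro (⟨hab, ⟨_, ha⟩, _, hb⟩ | ⟨u, ⟨hvu, hu⟩, ⟨rfl, rfl⟩ | ⟨rfl, rfl⟩⟩)
        · exact ⟨hab, ha, hb⟩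
        · exact ⟨hvu, hv, hu⟩
        · exact ⟨hvu.symm, hu, hv⟩
  · rw [Finset.disjoint_left]
    intro e he he'
    obtain ⟨u, _, rfl⟩ := Finset.mem_image.mp he'
    have := (Finset.mem_filter.mp he).2 v (Sym2.mem_mk_left _ _)
    simp at this

/-- The vertices of `C` are removed one at a time; neighbour counts only decrease along the way. -/
theorem edgesIn_le_sdiff {S C : Finset V} (hC : C ⊆ S) {q : ℕ}
    (h : ∀ u ∈ C, (G.neighborFinset u ∩ S).card ≤ q) :
    edgesIn G S ≤ edgesIn G (S \ C) + C.card * q := by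
  induction C using Finset.induction_on with
  | empty => simp
  | insert a C ha ih =>
    have h1 := ih ((Finset.subset_insert _ _).trans hC) fun u hu => h u (Finset.mem_insert_of_mem hu)
    have h2 := edgesIn_erase G (S := S \ C) (v := a)
      (Finset.mem_sdiff.mpr ⟨hC (Finset.mem_insert_self _ _), ha⟩)
    have h3 : (G.neighborFinset a ∩ (S \ C)).card ≤ q :=
      (Finset.card_le_card (Finset.inter_subset_inter_left Finset.sdiff_subset)).trans
        (h a (Finset.mem_insert_self _ _))
    have h4 : (S \ C).erase a = S \ insert a C := by
      ext x; simp only [Finset.mem_erase, Finset.mem_sdiff, Finset.mem_insert]; tauto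
    rw [h4] at h2
    rw [Finset.card_insert_of_notMem ha, add_mul]
    omega

/-- For the least vertex of `S`, all neighbours in `S` are larger. -/
theorem IsDegenerate.exists_card_neighbor_le {G : SimpleGraph V} [DecidableRel G.Adj] {d : ℕ}
    (hd : IsDegenerate G d) {S : Finset V} (hS : S.Nonempty) :
    ∃ v ∈ S, (G.neighborFinset v ∩ S).card ≤ d := by
  obtain ⟨o, ho⟩ := hd
  obtain ⟨v, hv, hmin⟩ := S.exists_minimal hS
  refine ⟨v, hv, ?_⟩
  have hsub : ((G.neighborFinset v ∩ S : Finset V) : Set V) ⊆ olderNeighbors G v := by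
    intro u hu
    simp only [Finset.coe_inter, Set.mem_inter_iff, Finset.mem_coe,
      SimpleGraph.mem_neighborFinset] at hu
    refine ⟨?_, hu.1⟩
    rcases lt_trichotomy v u with h | h | h
    · exact h
    · exact absurd (h ▸ hu.1) (G.loopless.irrefl _)
    · exact absurd (hmin hu.2 h.le) (not_le.mpr h)
  have := (Set.encard_le_encard hsub).trans (ho v)
  rw [Set.encard_coe_eq_coe_finsetCard] at this
  exact_mod_cast this

end Edges

end GraphVar

namespace GraphVar

/-! ### The bound on the transcendence degree and its equality case. -/

section Bound

variable {k K V ι : Type*} [Field k] [Field K] [Algebra k K] [Fintype ι] [DecidableEq ι]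
  [Fintype V] [DecidableEq V] {G : SimpleGraph V} [DecidableRel G.Adj] {A : Matrix ι ι k}
  {w : V → ι → K}

/-- The induction step for bounding the transcendence degree of a point: `c` is the defect of the
rank of the vectors at the neighbours of `v`. -/
theorem exists_rank_defect (hA : A.det ≠ 0) (hw : IsPoint G A w) {S : Finset V}
    {v : V} (hv : v ∈ S)
    (ih : ∀ T ⊂ S, trk k (coords w T) + edgesIn G T ≤ T.card * Fintype.card ι) :
    ∃ r c : ℕ, r + c = (G.neighborFinset v ∩ S).card ∧ r ≤ Fintype.card ι ∧
      trk k (coords w S) + r ≤ trk k (coords w (S.erase v)) + Fintype.card ι ∧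
      trk k (coords w S) + edgesIn G S + c * Fintype.card ι ≤
        S.card * Fintype.card ι + c * (G.maxDegree + r) ∧
      (c = 0 → LinearIndependent K fun u : (G.neighborFinset v ∩ S : Finset V) => w u) := by
  set N := G.neighborFinset v ∩ S with hN
  have hvN : v ∉ N := by simp [hN]
  have hNadj : ∀ u ∈ N, G.Adj v u := fun u hu => by
    simpa [hN] using (Finset.mem_inter.mp hu).1
  -- `b` indexes a maximal independent subfamily, so `r` is `b.card` and the vectors at `N \ b` lie
  -- in its span.
  obtain ⟨b, hbN, -, hspan, hli⟩ := exists_linearIndepOn_extension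
    (linearIndepOn_empty K w) (Set.empty_subset (N : Set V))
  lift b to Finset V using N.finite_toSet.subset hbN
  have hbN : b ⊆ N := by exact_mod_cast hbN
  have hNS : N ⊆ S.erase v := fun u hu =>
    Finset.mem_erase.mpr ⟨fun h => hvN (h ▸ hu), (Finset.mem_inter.mp hu).2⟩
  have hcard := Finset.card_sdiff_add_card_eq_card hbN
  obtain ⟨h1, h2⟩ := trk_coords_add_le (k := k) hA hw hv (hbN.trans hNS)
    (fun u hu => hNadj u (hbN hu)) hli
  refine ⟨b.card, (N \ b).card, by omega, h1, h2, ?_, fun h0 => ?_⟩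
  · have h3 := trk_coords_le_of_span (k := k) w (S := S.erase v) (C := N \ b) (R := b)
      Finset.sdiff_disjoint (hbN.trans hNS)
      fun u hu => hspan ⟨u, (Finset.mem_sdiff.mp hu).1, rfl⟩
    have h4 := ih (S.erase v \ (N \ b))
      (Finset.ssubset_of_subset_of_ssubset Finset.sdiff_subset (Finset.erase_ssubset hv))
    have h5 := edgesIn_erase G hv
    -- The bound is `maxDegree - 1` because each vertex of `N \ b` has the neighbour `v`, already
    -- removed.
    have h6 := edgesIn_le_sdiff G (S := S.erase v) (C := N \ b) (Finset.sdiff_subset.trans hNS)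
      (q := G.maxDegree - 1) fun u hu => by
        have hvu := hNadj u (Finset.mem_sdiff.mp hu).1
        have : G.neighborFinset u ∩ S.erase v ⊆ (G.neighborFinset u).erase v := fun x hx => by
          have := Finset.mem_inter.mp hx
          exact Finset.mem_erase.mpr ⟨(Finset.mem_erase.mp this.2).1, this.1⟩
        refine (Finset.card_le_card this).trans ?_
        rw [Finset.card_erase_of_mem (by simpa using hvu.symm), G.card_neighborFinset_eq_degree]
        exact Nat.sub_le_sub_right (G.degree_le_maxDegree u) 1
    have h7 := Finset.card_sdiff_add_card_eq_card (Finset.sdiff_subset.trans hNS : N \ b ⊆ S.erase v)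
    have h8 := Finset.card_erase_add_one hv
    rw [← hN] at h5
    -- The subtraction truncates only if `maxDegree` is 0, and then `N \ b` is empty.
    have h9 : (N \ b).card * (G.maxDegree - 1) + (N \ b).card = (N \ b).card * G.maxDegree := by
      rcases (N \ b).eq_empty_or_nonempty with h | ⟨u, hu⟩
      · simp [h]
      · have hvu := hNadj u (Finset.mem_sdiff.mp hu).1
        have h10 : 0 < G.degree v := (G.degree_pos_iff_exists_adj v).mpr ⟨u, hvu⟩
        have h11 := G.degree_le_maxDegree v
        obtain ⟨m, hm⟩ : ∃ m, G.maxDegree = m + 1 := ⟨G.maxDegree - 1, by omega⟩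
        rw [hm, Nat.add_sub_cancel, mul_add, mul_one]
    rw [← h8, ← h7, mul_add, add_mul, add_mul, one_mul]
    omega
  · have : N ⊆ b := by
      rwa [Finset.card_eq_zero, Finset.sdiff_eq_empty_iff_subset] at h0
    rw [Finset.Subset.antisymm this hbN]
    exact hli

/-- The transcendence degree of a point of the graph variety is at most the expected dimension. -/
theorem trk_coords_add_edgesIn_le (hA : A.det ≠ 0) (hw : IsPoint G A w) {d : ℕ}
    (hd : IsDegenerate G d) (hdim : d + G.maxDegree ≤ Fintype.card ι + 1) (S : Finset V) :
    trk k (coords w S) + edgesIn G S ≤ S.card * Fintype.card ι := by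
  induction S using Finset.strongInduction with
  | H S ih =>
    rcases S.eq_empty_or_nonempty with rfl | hS
    · have h0 : coords w ∅ = ∅ := Set.range_eq_empty _
      have h1 : edgesIn G ∅ = 0 := by
        rw [edgesIn, Finset.card_eq_zero, Finset.filter_eq_empty_iff]
        intro e _ h
        induction e using Sym2.ind with
        | _ a b => simpa using h a (Sym2.mem_mk_left _ _)
      simp [h0, h1, trk]
    · obtain ⟨v, hv, hvd⟩ := hd.exists_card_neighbor_le hS
      obtain ⟨r, c, hrc, -, -, h, -⟩ := exists_rank_defect hA hw hv ih
      have : c * (G.maxDegree + r) ≤ c * Fintype.card ι := by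
        rcases Nat.eq_zero_or_pos c with rfl | hc
        · simp
        -- Here `r + c ≤ d` and `c > 0` give `r ≤ d - 1`.
        · exact Nat.mul_le_mul_left c (by omega)
      omega

/-- At a point of maximal transcendence degree the vectors at the neighbours of a vertex with few
neighbours are independent, and the point is still generic after removing the vertex. -/
theorem generic_erase (hA : A.det ≠ 0) (hw : IsPoint G A w) {d : ℕ}
    (hd : IsDegenerate G d) (hdim : d + G.maxDegree ≤ Fintype.card ι) {S : Finset V} {v : V}
    (hv : v ∈ S) (hvd : (G.neighborFinset v ∩ S).card ≤ d)
    (hS : S.card * Fintype.card ι ≤ trk k (coords w S) + edgesIn G S) :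
    (LinearIndependent K fun u : (G.neighborFinset v ∩ S : Finset V) => w u) ∧
      (G.neighborFinset v ∩ S).card ≤ Fintype.card ι ∧
      trk k (coords w (S.erase v)) + (Fintype.card ι - (G.neighborFinset v ∩ S).card) ≤
        trk k (coords w S) ∧
      (S.erase v).card * Fintype.card ι ≤
        trk k (coords w (S.erase v)) + edgesIn G (S.erase v) := by
  obtain ⟨r, c, hrc, hr, h1, h2, h3⟩ := exists_rank_defect hA hw hv
    fun T _ => trk_coords_add_edgesIn_le hA hw hd (by omega) T
  have hc : c = 0 := by
    by_contra hc
    have hc' : 0 < c := Nat.pos_of_ne_zero hc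
    -- Again `r ≤ d - 1`; the stronger hypothesis makes the loss strict, against maximality.
    have : c * (G.maxDegree + r) < c * Fintype.card ι := Nat.mul_lt_mul_of_pos_left (by omega) hc'
    omega
  subst hc
  have h4 := edgesIn_erase G hv
  have h5 := trk_coords_add_edgesIn_le hA hw hd (by omega : _ ≤ Fintype.card ι + 1) (S.erase v)
  have h6 : S.card * Fintype.card ι = (S.erase v).card * Fintype.card ι + Fintype.card ι := by
    rw [← Finset.card_erase_add_one hv]; ring
  exact ⟨h3 rfl, by omega, by omega, by omega⟩

end Bound

end GraphVar

namespace GraphVar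

/-! ### Uniqueness of the generic point. -/

/-- A homomorphism to a field with kernel `p` extends to the fraction field of the quotient
by `p`. -/
theorem exists_lift_fractionRing {k R K : Type*} [Field k] [CommRing R] [Algebra k R] [Field K]
    [Algebra k K] (p : Ideal R) [p.IsPrime] (φ : R →ₐ[k] K) (h : ∀ f, f ∈ p ↔ φ f = 0) :
    ∃ j : FractionRing (R ⧸ p) →ₐ[k] K,
      ∀ f, j (algebraMap _ _ (Ideal.Quotient.mk p f)) = φ f := by
  let g : R ⧸ p →ₐ[k] K := Ideal.Quotient.liftₐ p φ fun a ha => (h a).mp ha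
  have hg : Function.Injective g := by
    rw [injective_iff_map_eq_zero]
    intro a ha
    obtain ⟨a, rfl⟩ := Ideal.Quotient.mk_surjective a
    exact Ideal.Quotient.eq_zero_iff_mem.mpr ((h a).mpr ha)
  exact ⟨IsFractionRing.liftAlgHom hg, fun f => by
    rw [IsFractionRing.liftAlgHom_apply, IsFractionRing.lift_algebraMap]; rfl⟩

section Update

variable {K V ι : Type*} [Zero K] [DecidableEq V]

theorem coords_update (w : V → ι → K) (S : Finset V) (v : V) :
    coords (Function.update w v 0) (S.erase v) = coords w (S.erase v) :=
  congrArg Set.range (funext fun p => by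
    rw [Function.update_of_ne (Finset.mem_erase.mp p.1.2).1])

theorem update_eq_zero {w : V → ι → K} {S : Finset V} {v : V} (hz : ∀ u ∉ S, w u = 0) :
    ∀ u ∉ S.erase v, Function.update w v 0 u = 0 := by
  intro u hu
  by_cases h : u = v
  · subst h; simp
  · rw [Function.update_of_ne h]
    exact hz u fun hS => hu (Finset.mem_erase.mpr ⟨h, hS⟩)

end Update

section Unique

variable {k K V ι : Type*} [Field k] [Field K] [Algebra k K]

/-- Evaluation of a polynomial at a point of `W ^ V`. -/
noncomputable abbrev evalAt (w : V → ι → K) : MvPolynomial (V × ι) k →ₐ[k] K :=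
  MvPolynomial.aeval fun p => w p.1 p.2

variable [DecidableEq V]

theorem evalAt_update_mem {w : V → ι → K} {S : Finset V} {v : V} (hz : ∀ u ∉ S, w u = 0)
    (f : MvPolynomial (V × ι) k) : evalAt (Function.update w v 0) f ∈
      IntermediateField.adjoin k (coords w (S.erase v)) := by
  induction f using MvPolynomial.induction_on with
  | C a => simp [evalAt]
  | add f g hf hg => rw [map_add]; exact add_mem hf hg
  | mul_X f p hf =>
    rw [map_mul]
    refine mul_mem hf ?_
    rw [evalAt, MvPolynomial.aeval_X]
    by_cases h : p.1 ∈ S.erase v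
    · rw [← coords_update]
      exact IntermediateField.subset_adjoin _ _ (mem_coords h _)
    · rw [update_eq_zero hz _ h]
      exact zero_mem _

variable [Fintype ι]

/-- Setting a vector to zero plays the role of deleting its vertex, which keeps the induction inside
one polynomial ring. -/
theorem IsPoint.update {G : SimpleGraph V} {A : Matrix ι ι k} {w : V → ι → K}
    (hw : IsPoint G A w) (v : V) : IsPoint G A (Function.update w v 0) := by
  intro a b hab
  by_cases ha : a = v
  · subst ha; simp
  by_cases hb : b = v
  · subst hb; simp
  rw [Function.update_of_ne ha, Function.update_of_ne hb]
  exact hw a b hab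

/-- The vanishing of polynomials at a point which is generic over its restriction to the complement
of `v` is detected on the parametrization of the vector at `v`. -/
theorem evalAt_eq_zero_iff {L : Type*} [Field L] [Algebra k L] [Algebra L K] [IsScalarTower k L K]
    {w : V → ι → K} {S : Finset V} {v : V} (hv : v ∈ S)
    (hL : ∀ l : L, algebraMap L K l ∈
      (AlgebraicIndependent.matroid k K).closure (coords w (S.erase v)))
    (x : V → ι → L) (hx : ∀ u, u ≠ v → ∀ i, algebraMap L K (x u i) = w u i)
    {τ : Type*} [Fintype τ] (U : Matrix ι τ L) (t : τ → K)
    (ht : (U.map (algebraMap L K)).mulVec t = w v)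
    (hrk : trk k (coords w (S.erase v)) + Fintype.card τ ≤ trk k (coords w S))
    (f : MvPolynomial (V × ι) k) :
    evalAt w f = 0 ↔ MvPolynomial.aeval (fun p : V × ι => if p.1 = v then
      ∑ j, MvPolynomial.C (U p.2 j) * MvPolynomial.X j else
      (MvPolynomial.C (x p.1 p.2) : MvPolynomial τ L)) f = 0 := by
  have h1 := trk_coords_le_of_eq_mulVec (k := k) w hv (U.map (algebraMap L K))
    (fun i j => hL (U i j)) t ht
  -- Evaluation at `w` is substitution of the parametrization followed by evaluation at `t`, which
  -- is injective by this independence. The criterion then involves only `L`, `x` and `U`.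
  have hind := algebraicIndependent_of_trk (finite_coords w (S.erase v)) t (hrk.trans h1) L hL
  have h2 : evalAt w = ((MvPolynomial.aeval (R := L) t).restrictScalars k).comp
      (MvPolynomial.aeval (fun p : V × ι => if p.1 = v then
        ∑ j, MvPolynomial.C (U p.2 j) * MvPolynomial.X j else
        (MvPolynomial.C (x p.1 p.2) : MvPolynomial τ L))) := by
    apply MvPolynomial.algHom_ext
    rintro ⟨a, i⟩
    simp only [evalAt, MvPolynomial.aeval_X, AlgHom.comp_apply, AlgHom.restrictScalars_apply]
    split_ifs with ha
    · subst ha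
      rw [← ht]
      simp [Matrix.mulVec, dotProduct]
    · simp [hx a ha i]
  rw [h2, AlgHom.comp_apply, AlgHom.restrictScalars_apply]
  exact map_eq_zero_iff _ hind

variable [Fintype V] {G : SimpleGraph V} [DecidableRel G.Adj] [DecidableEq ι]

/-- Any two generic points of the graph variety satisfy the same polynomial equations. -/
theorem evalAt_eq_zero_iff_of_generic {K₁ K₂ : Type*} [Field K₁] [Algebra k K₁] [Field K₂]
    [Algebra k K₂] {A : Matrix ι ι k} (hA : A.det ≠ 0) {d : ℕ}
    (hd : IsDegenerate G d) (hdim : d + G.maxDegree ≤ Fintype.card ι) (S : Finset V) :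
    ∀ (w₁ : V → ι → K₁) (w₂ : V → ι → K₂), IsPoint G A w₁ → IsPoint G A w₂ →
    (∀ v ∉ S, w₁ v = 0) → (∀ v ∉ S, w₂ v = 0) →
    S.card * Fintype.card ι ≤ trk k (coords w₁ S) + edgesIn G S →
    S.card * Fintype.card ι ≤ trk k (coords w₂ S) + edgesIn G S →
    ∀ f : MvPolynomial (V × ι) k, evalAt w₁ f = 0 ↔ evalAt w₂ f = 0 := by
  induction S using Finset.strongInduction with
  | H S ih =>
    intro w₁ w₂ hw₁ hw₂ hz₁ hz₂ hS₁ hS₂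
    rcases S.eq_empty_or_nonempty with rfl | hS
    · intro f
      have e₁ : (fun p : V × ι => w₁ p.1 p.2) = 0 := by
        ext p; exact congrFun (hz₁ p.1 (by simp)) p.2
      have e₂ : (fun p : V × ι => w₂ p.1 p.2) = 0 := by
        ext p; exact congrFun (hz₂ p.1 (by simp)) p.2
      rw [evalAt, evalAt, e₁, e₂, MvPolynomial.aeval_zero, MvPolynomial.aeval_zero]
      simp
    obtain ⟨v, hv, hvd⟩ := hd.exists_card_neighbor_le hS
    obtain ⟨hli₁, hN, hr₁, hg₁⟩ := generic_erase hA hw₁ hd hdim hv hvd hS₁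
    obtain ⟨-, -, hr₂, hg₂⟩ := generic_erase hA hw₂ hd hdim hv hvd hS₂
    have hih := ih (S.erase v) (Finset.erase_ssubset hv) (Function.update w₁ v 0)
      (Function.update w₂ v 0) (hw₁.update v) (hw₂.update v) (update_eq_zero hz₁) (update_eq_zero hz₂)
      (by rwa [coords_update]) (by rwa [coords_update])
    -- By induction `p` is also the vanishing ideal of the restriction of `w₂`, so its residue field
    -- `L` embeds in both `K₁` and `K₂`.
    let p := RingHom.ker (evalAt (k := k) (Function.update w₁ v 0))
    have hp : p.IsPrime := RingHom.ker_isPrime _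
    let L := FractionRing (MvPolynomial (V × ι) k ⧸ p)
    let ψ : MvPolynomial (V × ι) k →+* L :=
      (algebraMap (MvPolynomial (V × ι) k ⧸ p) L).comp (Ideal.Quotient.mk p)
    have hψ : ∀ l : L, ∃ a b, l = ψ a / ψ b := fun l => by
      obtain ⟨a, b, -, rfl⟩ := IsFractionRing.div_surjective (A := MvPolynomial (V × ι) k ⧸ p) l
      obtain ⟨a, rfl⟩ := Ideal.Quotient.mk_surjective a
      obtain ⟨b, rfl⟩ := Ideal.Quotient.mk_surjective b
      exact ⟨a, b, rfl⟩
    obtain ⟨j₁, hj₁⟩ := exists_lift_fractionRing p (evalAt (Function.update w₁ v 0))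
      fun _ => Iff.rfl
    obtain ⟨j₂, hj₂⟩ := exists_lift_fractionRing p (evalAt (Function.update w₂ v 0)) hih
    let _ : Algebra L K₁ := j₁.toRingHom.toAlgebra
    let _ : Algebra L K₂ := j₂.toRingHom.toAlgebra
    have : IsScalarTower k L K₁ := .of_algebraMap_eq fun a => (j₁.commutes a).symm
    have : IsScalarTower k L K₂ := .of_algebraMap_eq fun a => (j₂.commutes a).symm
    let x : V → ι → L := fun u i => ψ (MvPolynomial.X (u, i))
    have hx₁ : ∀ u, u ≠ v → ∀ i, algebraMap L K₁ (x u i) = w₁ u i := fun u hu i =>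
      (hj₁ _).trans (by simp [Function.update_of_ne hu])
    have hx₂ : ∀ u, u ≠ v → ∀ i, algebraMap L K₂ (x u i) = w₂ u i := fun u hu i =>
      (hj₂ _).trans (by simp [Function.update_of_ne hu])
    have hL₁ : ∀ l : L, algebraMap L K₁ l ∈
        (AlgebraicIndependent.matroid k K₁).closure (coords w₁ (S.erase v)) := fun l => by
      obtain ⟨a, b, rfl⟩ := hψ l
      rw [map_div₀]
      exact adjoin_subset_closure _ (div_mem ((hj₁ a).symm ▸ evalAt_update_mem hz₁ a)
        ((hj₁ b).symm ▸ evalAt_update_mem hz₁ b))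
    have hL₂ : ∀ l : L, algebraMap L K₂ l ∈
        (AlgebraicIndependent.matroid k K₂).closure (coords w₂ (S.erase v)) := fun l => by
      obtain ⟨a, b, rfl⟩ := hψ l
      rw [map_div₀]
      exact adjoin_subset_closure _ (div_mem ((hj₂ a).symm ▸ evalAt_update_mem hz₂ a)
        ((hj₂ b).symm ▸ evalAt_update_mem hz₂ b))
    have hne : ∀ u : (G.neighborFinset v ∩ S : Finset V), (u : V) ≠ v := fun u hu => by
      simpa [hu] using u.2
    have hadj : ∀ u : (G.neighborFinset v ∩ S : Finset V), G.Adj v u := fun u => by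
      simpa using (Finset.mem_inter.mp u.2).1
    -- Independence is read off from `w₁`, but the parametrization is defined over `L` and applies
    -- to `w₂` as well.
    obtain ⟨-, U, T, Q, hUT⟩ := exists_parametrization_ker _
      (linearIndependent_rows (K := K₁) hA
        (fun u : (G.neighborFinset v ∩ S : Finset V) => x u) (by
          convert hli₁ using 2 with u
          exact funext fun i => hx₁ u (hne u) i))
    have h₁ := mulVec_map_parametrization (algebraMap L K₁) hUT (x := w₁ v)
      (map_rows_mulVec _ fun u => by
        rw [funext fun i => hx₁ u (hne u) i]; exact hw₁ v u (hadj u))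
    have h₂ := mulVec_map_parametrization (algebraMap L K₂) hUT (x := w₂ v)
      (map_rows_mulVec _ fun u => by
        rw [funext fun i => hx₂ u (hne u) i]; exact hw₂ v u (hadj u))
    intro f
    rw [evalAt_eq_zero_iff hv hL₁ x hx₁ U _ h₁ (by rwa [Fintype.card_fin, Fintype.card_coe]),
      evalAt_eq_zero_iff hv hL₂ x hx₂ U _ h₂ (by rwa [Fintype.card_fin, Fintype.card_coe])]

end Unique

end GraphVar

namespace GraphVar

/-! ### Dimension and irreducibility of a quotient ring. -/

/-- The Krull dimension of a quotient of a ring of dimension at most `n`, bounded in terms of the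
heights of the primes containing the ideal. -/
theorem ringKrullDim_quotient_le_of_le_height_add {R : Type*} [CommRing R] [IsNoetherianRing R]
    {n m : ℕ} (hR : ringKrullDim R ≤ n) (I : Ideal R)
    (h : ∀ P : Ideal R, P.IsPrime → I ≤ P → (n : ℕ∞) ≤ P.height + m) :
    ringKrullDim (R ⧸ I) ≤ m := by
  refine iSup_le fun p => ?_
  -- A chain in the quotient becomes a chain in `R` above `I`; the height of its first prime plus
  -- its length is at most `n`.
  let q : LTSeries (PrimeSpectrum R) := p.map (PrimeSpectrum.comap (Ideal.Quotient.mk I))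
    (RingHom.strictMono_comap_of_surjective Ideal.Quotient.mk_surjective)
  have hI : I ≤ q.head.asIdeal := by
    rw [LTSeries.head_map, PrimeSpectrum.comap_asIdeal]
    intro x hx
    rw [Ideal.mem_comap, Ideal.Quotient.eq_zero_iff_mem.mpr hx]
    exact zero_mem _
  have h1 := h q.head.asIdeal q.head.isPrime hI
  have : Nonempty (PrimeSpectrum R) := ⟨q.head⟩
  have h2 : ((q.head.asIdeal.height + q.length : ℕ∞) : WithBot ℕ∞) ≤ n := by
    refine le_trans ?_ hR
    rw [ringKrullDim, Order.krullDim_eq_iSup_height_add_coheight_of_nonempty]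
    refine WithBot.coe_le_coe.mpr (le_trans ?_ (le_iSup _ q.head))
    rw [← PrimeSpectrum.height_eq_orderHeight]
    exact add_le_add le_rfl Order.length_le_coheight_head
  have h3 : q.head.asIdeal.height + q.length ≤ (n : ℕ∞) := WithBot.coe_le_coe.mp h2
  have hfin : q.head.asIdeal.height ≠ ⊤ := Ideal.height_ne_top_of_isPrime
  have hq : q.length = p.length := rfl
  rw [hq] at h3
  lift q.head.asIdeal.height to ℕ using hfin with a
  norm_cast at h1 h3 ⊢
  omega

/-- The radical of `I` is the intersection of its minimal primes, here a single one. -/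
theorem isPrime_nilradical_quotient {R : Type*} [CommRing R] {I : Ideal R} (hI : I ≠ ⊤)
    (h : ∀ P ∈ I.minimalPrimes, ∀ Q ∈ I.minimalPrimes, P ≤ Q) : (nilradical (R ⧸ I)).IsPrime := by
  obtain ⟨P, hP⟩ := Ideal.nonempty_minimalPrimes hI
  have hrad : I.radical = P := by
    rw [← Ideal.sInf_minimalPrimes]
    exact le_antisymm (sInf_le hP) (le_sInf fun Q hQ => h P hP Q hQ)
  have hcomap : (nilradical (R ⧸ I)).comap (Ideal.Quotient.mk I) = P := by
    rw [nilradical, Ideal.zero_eq_bot, Ideal.comap_radical, ← RingHom.ker_eq_comap_bot,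
      Ideal.mk_ker, hrad]
  rw [← Ideal.map_comap_of_surjective _ Ideal.Quotient.mk_surjective (nilradical (R ⧸ I)), hcomap]
  have := hP.1.1
  exact Ideal.map_isPrime_of_surjective Ideal.Quotient.mk_surjective
    (by rw [Ideal.mk_ker]; exact hP.1.2)

/-! ### Equations of the graph variety. -/

section Ideal

variable {k V W ι : Type*} [Field k] [AddCommGroup W] [Module k W] [Fintype ι]
  {B : LinearMap.BilinForm k W} (b : Module.Basis ι k W)

theorem pairingPoly_swap (hB : B.IsSymm ∨ B.IsAlt) (v u : V) :
    pairingPoly B b u v = pairingPoly B b v u ∨ pairingPoly B b u v = -pairingPoly B b v u := by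
  rcases hB with hB | hB
  · left
    rw [pairingPoly, pairingPoly, Finset.sum_comm]
    refine Finset.sum_congr rfl fun i _ => Finset.sum_congr rfl fun j _ => ?_
    rw [hB.eq (b j) (b i) |>.symm]
    ring
  · right
    rw [pairingPoly, pairingPoly, Finset.sum_comm, ← Finset.sum_neg_distrib]
    refine Finset.sum_congr rfl fun i _ => ?_
    rw [← Finset.sum_neg_distrib]
    refine Finset.sum_congr rfl fun j _ => ?_
    rw [← hB.neg_eq (b i) (b j), map_neg]
    ring

/-- The ideal of the graph variety is generated by one equation for each edge. -/
theorem exists_graphIdeal_eq_span [Fintype V] [DecidableEq V] (G : SimpleGraph V)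
    [DecidableRel G.Adj] (hB : B.IsSymm ∨ B.IsAlt) :
    ∃ s : Finset (MvPolynomial (V × ι) k), s.card ≤ G.edgeFinset.card ∧
      graphIdeal G B b = Ideal.span s := by
  classical
  -- `e.out` orients each edge; the opposite orientation gives the same equation up to sign. One
  -- generator per edge is what Krull's theorem requires.
  refine ⟨G.edgeFinset.image fun e => pairingPoly B b e.out.1 e.out.2, Finset.card_image_le, ?_⟩
  apply le_antisymm
  · rw [graphIdeal, Ideal.span_le]
    rintro _ ⟨v, u, h, rfl⟩
    have hmem : pairingPoly B b s(v, u).out.1 s(v, u).out.2 ∈ Ideal.span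
        ((G.edgeFinset.image fun e => pairingPoly B b e.out.1 e.out.2 :
          Finset (MvPolynomial (V × ι) k)) : Set (MvPolynomial (V × ι) k)) :=
      Ideal.subset_span (Finset.mem_coe.mpr (Finset.mem_image.mpr ⟨s(v, u), by simpa using h, rfl⟩))
    have hout : s((s(v, u).out).1, (s(v, u).out).2) = s(v, u) := Quot.out_eq _
    rw [Sym2.eq_iff] at hout
    rcases hout with ⟨h1, h2⟩ | ⟨h1, h2⟩
    · rwa [h1, h2] at hmem
    · rw [h1, h2] at hmem
      rcases pairingPoly_swap b hB v u with h3 | h3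
      · rwa [h3] at hmem
      · rw [h3] at hmem
        exact neg_mem_iff.mp hmem
  · rw [Ideal.span_le]
    intro f hf
    obtain ⟨e, he, rfl⟩ := Finset.mem_image.mp (Finset.mem_coe.mp hf)
    refine Ideal.subset_span ⟨_, _, ?_, rfl⟩
    have hout : s(e.out.1, e.out.2) = e := Quot.out_eq _
    rw [← SimpleGraph.mem_edgeSet, hout]
    simpa using he

theorem evalAt_pairingPoly {K : Type*} [Field K] [Algebra k K] (w : V → ι → K) (v u : V) :
    evalAt w (pairingPoly B b v u) = w v ⬝ᵥ
      (Matrix.map (Matrix.of fun i j => B (b i) (b j)) (algebraMap k K)).mulVec (w u) := by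
  simp only [pairingPoly, map_sum, map_mul, evalAt, MvPolynomial.aeval_C, MvPolynomial.aeval_X,
    dotProduct, Matrix.mulVec, Finset.mul_sum, Matrix.map_apply, Matrix.of_apply]
  exact Finset.sum_congr rfl fun i _ => Finset.sum_congr rfl fun j _ => by ring

/-- The zeros of the ideal with coordinates in an extension field are the points of the graph
variety. -/
theorem isPoint_iff {K : Type*} [Field K] [Algebra k K] (G : SimpleGraph V) (w : V → ι → K) :
    IsPoint G (Matrix.of fun i j => B (b i) (b j)) w ↔
      graphIdeal G B b ≤ RingHom.ker (evalAt (k := k) w) := by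
  rw [graphIdeal, Ideal.span_le]
  constructor
  · rintro h _ ⟨v, u, hvu, rfl⟩
    exact (evalAt_pairingPoly b w v u).trans (h v u hvu)
  · intro h v u hvu
    exact (evalAt_pairingPoly b w v u).symm.trans (h ⟨v, u, hvu, rfl⟩)

end Ideal

/-! ### Primes as vanishing ideals of points. -/

section GenericPoint

variable {k V ι : Type*} [Field k]

/-- The tautological point of `W ^ V` with coordinates in the residue field of a prime ideal. -/
noncomputable def tautPoint (P : Ideal (MvPolynomial (V × ι) k)) [P.IsPrime] :
    V → ι → FractionRing (MvPolynomial (V × ι) k ⧸ P) := fun v i =>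
  algebraMap (MvPolynomial (V × ι) k ⧸ P) _ (Ideal.Quotient.mk P (MvPolynomial.X (v, i)))

theorem ker_evalAt_tautPoint (P : Ideal (MvPolynomial (V × ι) k)) [P.IsPrime] :
    RingHom.ker (evalAt (k := k) (tautPoint P)) = P := by
  have h : evalAt (k := k) (tautPoint P) =
      (IsScalarTower.toAlgHom k (MvPolynomial (V × ι) k ⧸ P) _).comp (Ideal.Quotient.mkₐ k P) := by
    apply MvPolynomial.algHom_ext
    rintro ⟨v, i⟩
    simp [evalAt, tautPoint]
  ext f
  rw [RingHom.mem_ker, h, AlgHom.comp_apply, IsScalarTower.toAlgHom_apply,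
    map_eq_zero_iff _ (IsFractionRing.injective _ _), Ideal.Quotient.mkₐ_eq_mk,
    Ideal.Quotient.eq_zero_iff_mem]

theorem isPoint_zero [Fintype ι] {K : Type*} [Field K] [Algebra k K] {G : SimpleGraph V}
    {A : Matrix ι ι k} : IsPoint G A (0 : V → ι → K) := fun v u _ => by simp

theorem trk_coords_zero {K : Type*} [Field K] [Algebra k K] (S : Finset V) :
    trk k (coords (0 : V → ι → K) S) = 0 := by
  have h : trk k (coords (0 : V → ι → K) S) ≤ trk k (∅ : Set K) := by
    apply trk_le_of_subset_closure Set.finite_empty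
    rintro _ ⟨p, rfl⟩
    exact mem_closure_iff.mpr isAlgebraic_zero
  simpa [trk] using h

theorem coords_univ [Fintype V] {K : Type*} (w : V → ι → K) :
    coords w Finset.univ = Set.range fun p : V × ι => w p.1 p.2 := by
  ext x
  constructor
  · rintro ⟨p, rfl⟩
    exact ⟨(p.1, p.2), rfl⟩
  · rintro ⟨p, rfl⟩
    exact mem_coords (Finset.mem_univ _) _

theorem card_le_height_ker_add_trk [Fintype V] [Fintype ι] {K : Type*} [Field K] [Algebra k K]
    (w : V → ι → K) : ((Fintype.card V * Fintype.card ι : ℕ) : ℕ∞) ≤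
      (RingHom.ker (evalAt (k := k) w)).height + trk k (coords w Finset.univ) := by
  have := card_le_height_add_trk (k := k) (V × ι) fun p => w p.1 p.2
  rw [Nat.card_eq_fintype_card, Fintype.card_prod] at this
  rw [coords_univ]
  exact this

end GenericPoint

/-! ### Dimension and irreducibility of the graph variety. -/

section Main

variable {k V W ι : Type*} [Field k] [AddCommGroup W] [Module k W] [Fintype ι]
  [DecidableEq ι] [Fintype V] [DecidableEq V] {G : SimpleGraph V} [DecidableRel G.Adj]
  {B : LinearMap.BilinForm k W} (b : Module.Basis ι k W)

theorem det_gram_ne_zero (hB : B.Nondegenerate) :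
    (Matrix.of fun i j => B (b i) (b j)).det ≠ 0 := by
  have := (LinearMap.BilinForm.nondegenerate_iff_det_ne_zero b).mp hB
  convert this using 2
  ext i j
  simp [LinearMap.BilinForm.toMatrix_apply]

theorem ringKrullDim_quotient_graphIdeal (hB : B.Nondegenerate) (hB' : B.IsSymm ∨ B.IsAlt)
    {d : ℕ} (hd : IsDegenerate G d) (hdim : d + G.maxDegree ≤ Fintype.card ι + 1) :
    ∃ n : ℕ, ringKrullDim (MvPolynomial (V × ι) k ⧸ graphIdeal G B b) = n ∧
      n + G.edgeFinset.card = Fintype.card V * Fintype.card ι := by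
  have hA := det_gram_ne_zero b hB
  -- The bound at the origin shows that the expected dimension is not negative.
  have h0 := trk_coords_add_edgesIn_le hA (isPoint_zero (K := k)) hd hdim Finset.univ
  rw [edgesIn_univ, Finset.card_univ] at h0
  obtain ⟨n, hn⟩ := Nat.exists_eq_add_of_le' (le_of_add_le_right h0)
  refine ⟨n, le_antisymm ?_ ?_, hn.symm⟩
  · apply ringKrullDim_quotient_le_of_le_height_add
      (n := Fintype.card V * Fintype.card ι)
    · rw [MvPolynomial.ringKrullDim_of_isNoetherianRing, ringKrullDim_eq_zero_of_field,
        Nat.card_eq_fintype_card, Fintype.card_prod, zero_add]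
    · intro P hP hIP
      have h1 := card_le_height_ker_add_trk (k := k) (tautPoint P)
      have h2 := trk_coords_add_edgesIn_le hA
        ((isPoint_iff b G (tautPoint P)).mpr (by rwa [ker_evalAt_tautPoint])) hd hdim Finset.univ
      rw [edgesIn_univ, Finset.card_univ] at h2
      rw [ker_evalAt_tautPoint] at h1
      refine h1.trans (add_le_add le_rfl ?_)
      norm_cast
      omega
  · obtain ⟨s, hs, hI⟩ := exists_graphIdeal_eq_span b G hB'
    have hle := (isPoint_iff (B := B) b G (0 : V → ι → k)).mp isPoint_zero
    have hprime : (RingHom.ker (evalAt (k := k) (0 : V → ι → k))).IsPrime := RingHom.ker_isPrime _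
    have h1 := card_le_height_ker_add_trk (k := k) (0 : V → ι → k)
    rw [trk_coords_zero, Nat.cast_zero, add_zero] at h1
    rw [hI] at hle ⊢
    -- The ideal of the origin contains the equations and has height at least |V| dim W; each
    -- equation lowers the dimension by at most one.
    have h2 := Ideal.height_le_ringKrullDim_quotient_add_encard (s : Set (MvPolynomial (V × ι) k))
      (Ideal.span_le.mp hle)
    rw [Set.encard_coe_eq_coe_finsetCard] at h2
    have h3 := (WithBot.coe_le_coe.mpr h1).trans h2
    generalize ringKrullDim (MvPolynomial (V × ι) k ⧸
      Ideal.span (s : Set (MvPolynomial (V × ι) k))) = r at h3 ⊢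
    rw [hn] at h3
    induction r with
    | bot => simp at h3
    | coe r =>
      norm_cast at h3 ⊢
      induction r with
      | top => exact le_top
      | coe r =>
        norm_cast at h3 ⊢
        omega

theorem isPrime_nilradical_quotient_graphIdeal (hB : B.Nondegenerate) (hB' : B.IsSymm ∨ B.IsAlt)
    {d : ℕ} (hd : IsDegenerate G d) (hdim : d + G.maxDegree ≤ Fintype.card ι) :
    (nilradical (MvPolynomial (V × ι) k ⧸ graphIdeal G B b)).IsPrime := by
  have hA := det_gram_ne_zero b hB
  obtain ⟨s, hs, hI⟩ := exists_graphIdeal_eq_span b G hB'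
  have key : ∀ P ∈ (graphIdeal G B b).minimalPrimes, ∀ [P.IsPrime],
      IsPoint G (Matrix.of fun i j => B (b i) (b j)) (tautPoint P) ∧
      (Finset.univ : Finset V).card * Fintype.card ι ≤
        trk k (coords (tautPoint P) Finset.univ) + edgesIn G Finset.univ := by
    intro P hP _
    refine ⟨(isPoint_iff b G _).mpr (by rw [ker_evalAt_tautPoint]; exact hP.1.2), ?_⟩
    rw [hI] at hP
    -- Height at most |E| forces transcendence degree at least |V| dim W - |E|.
    have h1 := Ideal.height_le_card_of_mem_minimalPrimes_span_finset hP
    have h2 := card_le_height_ker_add_trk (k := k) (tautPoint P)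
    rw [ker_evalAt_tautPoint] at h2
    have h3 := h2.trans (add_le_add h1 le_rfl)
    norm_cast at h3
    rw [edgesIn_univ, Finset.card_univ]
    omega
  apply isPrime_nilradical_quotient
  · intro htop
    have h0 := (isPoint_iff (B := B) b G (0 : V → ι → k)).mp isPoint_zero
    rw [htop] at h0
    exact (RingHom.ker_isPrime (evalAt (k := k) (0 : V → ι → k))).ne_top (top_le_iff.mp h0)
  · intro P hP Q hQ f hf
    have := hP.1.1
    have := hQ.1.1
    obtain ⟨hP1, hP2⟩ := key P hP
    obtain ⟨hQ1, hQ2⟩ := key Q hQ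
    have h := evalAt_eq_zero_iff_of_generic hA hd hdim Finset.univ _ _ hP1 hQ1
      (by simp) (by simp) hP2 hQ2 f
    rw [← ker_evalAt_tautPoint P] at hf
    rw [← ker_evalAt_tautPoint Q]
    exact h.mp hf

end Main

end GraphVar

theorem theoremA {k V W : Type*} [Field k] [Fintype V] [DecidableEq V]
    [AddCommGroup W] [Module k W] [FiniteDimensional k W]
    (G : SimpleGraph V) [DecidableRel G.Adj] (d D : ℕ)
    (hd : GraphVar.IsDegenerate G d) (hD : G.maxDegree = D)
    (B : LinearMap.BilinForm k W) (hB : B.Nondegenerate) (hB' : B.IsSymm ∨ B.IsAlt) :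
    ((d : ℤ) + (D : ℤ) - 1 ≤ (Module.finrank k W : ℤ) →
      ∃ n : ℕ, topologicalKrullDim (GraphVar.graphVariety G B) = n ∧
        (n : ℤ) = GraphVar.expectedDim G k W) ∧
    ((d : ℤ) + (D : ℤ) - 1 < (Module.finrank k W : ℤ) →
      IrreducibleSpace (GraphVar.graphVariety G B)) := by
  subst hD
  constructor
  · intro h
    obtain ⟨n, hn, hcard⟩ := GraphVar.ringKrullDim_quotient_graphIdeal (Module.finBasis k W) hB hB'
      hd (by rw [Fintype.card_fin]; omega)
    refine ⟨n, (PrimeSpectrum.topologicalKrullDim_eq_ringKrullDim _).trans hn, ?_⟩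
    rw [Fintype.card_fin] at hcard
    rw [GraphVar.expectedDim]
    zify at hcard
    omega
  · intro h
    exact (PrimeSpectrum.irreducibleSpace_iff_isPrime_nilradical).mpr
      (GraphVar.isPrime_nilradical_quotient_graphIdeal (Module.finBasis k W) hB hB' hd
        (by rw [Fintype.card_fin]; omega))
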